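/- Let $d\in\{2,3\}$, let $G=(V,E)$ be a simple undirected graph on $V=\{1,\dots,n\}$, and write $p=(p_1,\dots,p_n)\in\mathbb{R}^{dn}$ with $p_i\in\mathbb{R}^d$ for the positions of $n$ agents, and $b_{ij}(p)=\frac{p_j-p_i}{\|p_j-p_i\|}$ when $p_i\neq p_j$. Let $\mathcal S$ be a finite set of triples $(i,j,k)\in V^3$ if $d=2$, and of quadruples $(i,j,k,l)\in V^4$ if $d=3$. Each element of $\mathcal S$ gives a signed constraint, namely the signed angle constraint $\det\begin{bmatrix} b_{ij}(p) & b_{ik}(p)\end{bmatrix}$ if $d=2$, and the normalized signed volume $b_{ij}(p)^\top\big(b_{ik}(p)\times b_{il}(p)\big)$ if $d=3$. Let $\chi\subset\mathbb{R}^{dn}$ be the set of all $p$ at which all these signed constraints are defined (that is, none of the differences $p_j-p_i$, $p_k-p_i$, and $p_l-p_i$ if $d=3$, that occur in them vanishes). For $p\in\chi$ let $D(p)\in\mathbb{R}^{E}$ be the vector of the distance constraints $\frac12\|p_i-p_j\|^2$, $\{i,j\}\in E$, let $S(p)\in\mathbb{R}^{\mathcal S}$ be the vector of the signed constraints, and let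 $R(p)$ be the Jacobian matrix of $p\mapsto (D(p),S(p))$. The framework at $p\in\chi$ is called IRDS (infinitesimally rigid with distance and signed constraints) if every $v=(v_1,\dots,v_n)\in\mathbb{R}^{dn}$ with $R(p)v=0$ is trivial, i.e. of the form $v_i=Ap_i+b$ for all $i$, with a skew-symmetric $A\in\mathbb{R}^{d\times d}$ and $b\in\mathbb{R}^d$. Let $q\in\chi$ be a desired formation that is IRDS, let $k\neq 0$ be a real gain, and put $$e(p)=\begin{bmatrix} D(p)-D(q)\\ k\,S(p)-k\,S(q)\end{bmatrix},\qquad \bar R_D(p)=\begin{bmatrix}\partial D/\partial p\\ k\,\partial S/\partial p\end{bmatrix}.$$ Let $\psi$ be the set of all formations congruent to $q$, i.e. of all $p$ with $p_i=Qq_i+b$ for all $i$, for some rotation $Q\in SO(d)$ and some $b\in\mathbb{R}^d$. Theorem. For every $p^*\in\psi$ there are a neighbourhood $\mathcal B_{p^*}$ of $p^*$ and constants $C,\gamma>0$ such that for every $p_0\in\mathcal B_{p^*}$ the gradient system $$\dot p=-\bar R_D(p)^\top e(p),\qquad p(0)=p_0,$$ has a solution $p:[0,\infty)\to\chi$, and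 for every such solution there is a fixed formation $p^\dagger\in\psi$ with $\|p(t)-p^\dagger\|\le C e^{-\gamma t}$ for all $t\ge 0$. -/

import Mathlib

open Set Filter Topology Matrix

noncomputable section

namespace FormationControl

/-- Realizations `p = (p_1, …, p_n)` of `n` agents in `ℝ^d`: vectors of `ℝ^{dn}` with the Euclidean
norm; the coordinate `(i, a)` is the `a`-th coordinate of the position of agent `i`. -/
abbrev Config (d n : ℕ) : Type := EuclideanSpace ℝ (Fin n × Fin d)

variable {d n : ℕ}

/-- The position `p_i ∈ ℝ^d` of agent `i`. -/
def pos (p : Config d n) (i : Fin n) : EuclideanSpace ℝ (Fin d) :=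
  WithLp.toLp 2 fun a => p (i, a)

/-- The relative position `z_{ij} = p_i - p_j`. -/
def relPos (p : Config d n) (i j : Fin n) : EuclideanSpace ℝ (Fin d) :=
  pos p i - pos p j

/-- The unit vector `z_{ji} / ‖z_{ji}‖` pointing from agent `i` to agent `j`. -/
def bearing (p : Config d n) (i j : Fin n) : EuclideanSpace ℝ (Fin d) :=
  ‖relPos p j i‖⁻¹ • relPos p j i

/-- The distance constraint `½ ‖z_{ij}‖²` of an undirected edge `{i, j}`. -/
def halfSqDist (p : Config d n) (e : Sym2 (Fin n)) : ℝ :=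
  Sym2.lift ⟨fun i j => (1 / 2 : ℝ) * ‖relPos p i j‖ ^ 2,
    fun i j => by simp only [relPos]; rw [norm_sub_rev]⟩ e

/-- The signed angle constraint of `(i, j, k)` in the plane: the determinant of the matrix
whose columns are the unit vectors from `i` to `j` and from `i` to `k`. -/
def signedAngle (p : Config 2 n) (t : Fin n × Fin n × Fin n) : ℝ :=
  Matrix.det !![bearing p t.1 t.2.1 0, bearing p t.1 t.2.2 0;
                bearing p t.1 t.2.1 1, bearing p t.1 t.2.2 1]

/-- The normalized signed volume of `(i, j, k, l)` in space: the triple product `a ⬝ (b × c)` of the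
unit vectors `a`, `b`, `c` from `i` to `j`, `k` and `l`. -/
def signedVolume (p : Config 3 n) (t : Fin n × Fin n × Fin n × Fin n) : ℝ :=
  (bearing p t.1 t.2.1).ofLp ⬝ᵥ
    crossProduct (bearing p t.1 t.2.2.1).ofLp (bearing p t.1 t.2.2.2).ofLp

/-- The realizations in the plane at which every signed angle of the index set `S` is defined. -/
def angleDomain (S : Finset (Fin n × Fin n × Fin n)) : Set (Config 2 n) :=
  {p | ∀ t ∈ S, pos p t.2.1 ≠ pos p t.1 ∧ pos p t.2.2 ≠ pos p t.1}

/-- The realizations in space at which every signed volume of the index set `S` is defined. -/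
def volumeDomain (S : Finset (Fin n × Fin n × Fin n × Fin n)) : Set (Config 3 n) :=
  {p | ∀ t ∈ S, pos p t.2.1 ≠ pos p t.1 ∧ pos p t.2.2.1 ≠ pos p t.1 ∧ pos p t.2.2.2 ≠ pos p t.1}

/-- The vector of all signed angle constraints in `S`. -/
def signedAngles (S : Finset (Fin n × Fin n × Fin n)) (p : Config 2 n) (t : S) : ℝ :=
  signedAngle p t

/-- The vector of all signed volume constraints in `S`. -/
def signedVolumes (S : Finset (Fin n × Fin n × Fin n × Fin n)) (p : Config 3 n) (t : S) : ℝ :=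
  signedVolume p t

/-! In the definitions below `s` is the vector of the signed constraints, with index set `ι`:
`signedAngles S` in the plane and `signedVolumes S` in space. -/

variable {ι : Type}

/-- The rigidity function: the distance constraints followed by the signed constraints. -/
def rigidityFunction (G : SimpleGraph (Fin n)) (s : Config d n → ι → ℝ) (p : Config d n) :
    G.edgeSet ⊕ ι → ℝ :=
  Sum.elim (fun e => halfSqDist p e) (s p)

/-- The rigidity matrix: the Jacobian matrix of the rigidity function. -/
def rigidityMatrix (G : SimpleGraph (Fin n)) (s : Config d n → ι → ℝ) (p : Config d n) :
    Matrix (G.edgeSet ⊕ ι) (Fin n × Fin d) ℝ :=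
  Matrix.of fun r c =>
    fderiv ℝ (fun x => rigidityFunction G s x r) p (EuclideanSpace.single c (1 : ℝ))

/-- An infinitesimal motion of the framework: a solution `v` of `R(p) v = 0`. -/
def IsInfinitesimalMotion (G : SimpleGraph (Fin n)) (s : Config d n → ι → ℝ)
    (p v : Config d n) : Prop :=
  rigidityMatrix G s p *ᵥ v.ofLp = 0

/-- A trivial motion of `p`: a sum of an infinitesimal rotation (a skew-symmetric matrix applied to
all positions) and a translation of the whole framework. -/
def IsTrivialMotion (p v : Config d n) : Prop :=
  ∃ (A : Matrix (Fin d) (Fin d) ℝ) (b : Fin d → ℝ), Aᵀ = -A ∧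
    ∀ i, (pos v i).ofLp = A *ᵥ (pos p i).ofLp + b

/-- Infinitesimal rigidity with distance and signed constraints: all infinitesimal motions are
trivial. -/
def IsIRDS (G : SimpleGraph (Fin n)) (s : Config d n → ι → ℝ) (p : Config d n) : Prop :=
  ∀ v : Config d n, IsInfinitesimalMotion G s p v → IsTrivialMotion p v

/-- The realizations obtained from `q` by a rotation and a translation of the whole formation. -/
def congruenceClass (q : Config d n) : Set (Config d n) :=
  {p | ∃ Q ∈ Matrix.specialOrthogonalGroup (Fin d) ℝ, ∃ b : Fin d → ℝ,
    ∀ i, (pos p i).ofLp = Q *ᵥ (pos q i).ofLp + b}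

/-- The formation error `e(p)` with respect to the desired formation `q` and the gain `k`. -/
def formationError (G : SimpleGraph (Fin n)) (s : Config d n → ι → ℝ) (k : ℝ)
    (q p : Config d n) : G.edgeSet ⊕ ι → ℝ :=
  Sum.elim (fun e => halfSqDist p e - halfSqDist q e) (fun w => k * s p w - k * s q w)

/-- The rigidity matrix with the rows of the signed constraints multiplied by the gain `k`. -/
def weightedRigidityMatrix (G : SimpleGraph (Fin n)) (s : Config d n → ι → ℝ) (k : ℝ)
    (p : Config d n) : Matrix (G.edgeSet ⊕ ι) (Fin n × Fin d) ℝ :=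
  Matrix.of fun r c => Sum.elim (fun _ => 1) (fun _ => k) r * rigidityMatrix G s p r c

/-- The gradient control law, `p ↦ - R̄(p)ᵀ e(p)`. -/
def controlLaw (G : SimpleGraph (Fin n)) [DecidableRel G.Adj] [Fintype ι]
    (s : Config d n → ι → ℝ) (k : ℝ) (q p : Config d n) : Config d n :=
  WithLp.toLp 2 (-((weightedRigidityMatrix G s k p)ᵀ *ᵥ formationError G s k q p))

/-- A trajectory of `ṗ = f(p)`, `t ≥ 0`, inside the set `χ` where `f` is defined. -/
def IsTrajectory (χ : Set (Config d n)) (f : Config d n → Config d n)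
    (p : ℝ → Config d n) : Prop :=
  IsIntegralCurveOn p (fun _ => f) (Ici 0) ∧ ∀ t, 0 ≤ t → p t ∈ χ

/-- Each `p⋆ ∈ ψ` has a neighbourhood such that trajectories of `ṗ = f(p)` exist for all `t ≥ 0`
from every initial point in it, and all of them converge exponentially fast to a point of `ψ`. -/
def LocallyExponentiallyConvergent (χ : Set (Config d n)) (f : Config d n → Config d n)
    (ψ : Set (Config d n)) : Prop :=
  ∀ pstar ∈ ψ, ∃ B ∈ 𝓝 pstar, ∃ C > (0 : ℝ), ∃ γ > (0 : ℝ), ∀ p₀ ∈ B,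
    (∃ p : ℝ → Config d n, IsTrajectory χ f p ∧ p 0 = p₀) ∧
    ∀ p : ℝ → Config d n, IsTrajectory χ f p → p 0 = p₀ →
      ∃ plim ∈ ψ, ∀ t, 0 ≤ t → ‖p t - plim‖ ≤ C * Real.exp (-γ * t)

end FormationControl

end

/-! The control law is the negative gradient of `½ ‖F x - F q‖²`, where `F` is the vector of
weighted constraints. As `F` is constant along rigid motions, its level set through `q` contains the
whole orbit, so one cannot expect an asymptotically stable isolated equilibrium. What replaces it is
a gradient domination inequality `c * ‖F x - F q‖ ≤ ‖gradient‖` near each point of the orbit.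

Given that inequality, the residual decays like `exp (-c² t)`, and the speed is at most a constant
times the residual. The trajectory therefore has finite length, proportional to the initial
residual. It cannot leave a small ball, it is Cauchy, and its limit has zero residual
(`exists_nhds_exponentially_convergent`).

For the inequality, move `x` by the rigid motion that brings it closest to `q`, to a point `y`.
First-order minimality makes `y - q` orthogonal to the trivial motions of `q`, hence by IRDS to the
kernel of the derivative of `F` at `q`. That derivative is bounded below on such vectors, and
`gradient_dominated_on_slice` gives the inequality at `y`; it also gives `y = q` when `F y = F q`.
Invariance of `F` and of the gradient norm carries both facts back to `x`. -/

noncomputable section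

namespace FormationControl

/-! ### Gradient flows of least-squares residuals under gradient domination -/

section GradientFlow

variable {E W : Type*} [NormedAddCommGroup E] [InnerProductSpace ℝ E] [CompleteSpace E]
  [NormedAddCommGroup W] [InnerProductSpace ℝ W] [CompleteSpace W]

/-- A bounded Lipschitz vector field has integral curves on `[0, ∞)`. -/
theorem exists_isIntegralCurveOn_Ici {f : E → E} {K L : NNReal} (hK : LipschitzWith K f)
    (hL : ∀ x, ‖f x‖ ≤ L) (x₀ : E) :
    ∃ p : ℝ → E, p 0 = x₀ ∧ IsIntegralCurveOn p (fun _ => f) (Ici 0) := by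
  have key : ∀ n : ℕ, ∃ α : ℝ → E, α 0 = x₀ ∧
      ∀ t ∈ Icc (0 : ℝ) n, HasDerivWithinAt α (f (α t)) (Icc (0 : ℝ) n) t := by
    intro n
    -- A curve of speed at most `L` travels at most `L * n` in time `n`, so with this radius the
    -- Picard–Lindelöf theorem puts no limit on the length of the interval.
    have hPL : IsPicardLindelof (fun _ => f) (tmin := 0) (tmax := n)
        ⟨0, left_mem_Icc.2 n.cast_nonneg⟩ x₀ (L * n) 0 L K :=
      { lipschitzOnWith := fun _ _ => hK.lipschitzOnWith
        continuousOn := fun _ _ => continuousOn_const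
        norm_le := fun _ _ x _ => hL x
        mul_max_le := by simp }
    exact hPL.exists_eq_forall_mem_Icc_hasDerivWithinAt₀
  choose α hα0 hα using key
  have right : ∀ n : ℕ, ∀ t ∈ Ico (0 : ℝ) n, HasDerivWithinAt (α n) (f (α n t)) (Ici t) t := by
    intro n t ht
    exact (hα n t ⟨ht.1, ht.2.le⟩).mono_of_mem_nhdsWithin
      (mem_of_superset (Icc_mem_nhdsGE ht.2) (Icc_subset_Icc_left ht.1))
  have mono : ∀ m n : ℕ, m ≤ n → EqOn (α m) (α n) (Icc (0 : ℝ) m) := by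
    intro m n hmn
    have hmn' : (m : ℝ) ≤ n := by exact_mod_cast hmn
    refine ODE_solution_unique_of_mem_Icc_right (v := fun _ => f) (s := fun _ => univ) (K := K)
      (fun _ _ => hK.lipschitzOnWith) (fun t ht => (hα m t ht).continuousWithinAt) (right m)
      (fun _ _ => mem_univ _) ?_ ?_ (fun _ _ => mem_univ _) ((hα0 m).trans (hα0 n).symm)
    · exact fun t ht => ((hα n t ⟨ht.1, ht.2.trans hmn'⟩).continuousWithinAt).mono
        (Icc_subset_Icc_right hmn')
    · exact fun t ht => right n t ⟨ht.1, ht.2.trans_le hmn'⟩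
  -- The `+ 1` keeps `t` strictly below the right endpoint, so that near `t` the interval of the
  -- local solution fills `Ici 0`.
  set p : ℝ → E := fun t => α (⌈t⌉₊ + 1) t with hp
  have hpα : ∀ n : ℕ, ∀ t ∈ Icc (0 : ℝ) n, p t = α n t := by
    intro n t ht
    have ht' : t ∈ Icc (0 : ℝ) ((⌈t⌉₊ + 1 : ℕ) : ℝ) :=
      ⟨ht.1, (Nat.le_ceil t).trans (by push_cast; linarith)⟩
    rcases le_total n (⌈t⌉₊ + 1) with h | h
    · exact (mono _ _ h ht).symm
    · exact mono _ _ h ht'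
  refine ⟨p, by simpa using hpα 0 0 (by simp) |>.trans (hα0 0), fun t ht => ?_⟩
  have ht0 : (0 : ℝ) ≤ t := ht
  set n := ⌈t⌉₊ + 1 with hn
  have htn : t < n := (Nat.le_ceil t).trans_lt (by rw [hn]; push_cast; linarith)
  have hmem : Icc (0 : ℝ) n ∈ 𝓝[Ici 0] t := by
    rw [← Ici_inter_Iic]
    exact inter_mem self_mem_nhdsWithin (mem_nhdsWithin_of_mem_nhds (Iic_mem_nhds htn))
  have h1 := (hα n t ⟨ht0, htn.le⟩).mono_of_mem_nhdsWithin hmem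
  rw [← hpα n t ⟨ht0, htn.le⟩] at h1
  exact h1.congr_of_eventuallyEq (mem_of_superset hmem fun s hs => hpα n s hs)
    (hpα n t ⟨ht0, htn.le⟩)

/-- The negative gradient of `½ ‖F x - w₀‖²`. -/
def residualFlow (F : E → W) (w₀ : W) (x : E) : E :=
  -(ContinuousLinearMap.adjoint (fderiv ℝ F x) (F x - w₀))

variable {F : E → W} {w₀ : W} {U : Set E} {M c : ℝ}

/-- Along the flow the squared residual has derivative `-2 ‖gradient‖²`, at most `-2 c²` times
itself; apply Grönwall and take the square root. -/
theorem norm_residual_le_of_gradient_dominated (hF : ∀ x ∈ U, DifferentiableAt ℝ F x)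
    (hPL : ∀ x ∈ U, c * ‖F x - w₀‖ ≤ ‖residualFlow F w₀ x‖) (hc : 0 < c)
    {p : ℝ → E} {T : ℝ} (hp : ContinuousOn p (Icc 0 T))
    (hp' : ∀ t ∈ Ico 0 T, HasDerivWithinAt p (residualFlow F w₀ (p t)) (Ici t) t)
    (hU : ∀ t ∈ Ico 0 T, p t ∈ U) {s : ℝ} (hs : s ∈ Ico 0 T) :
    ‖F (p s) - w₀‖ ≤ ‖F (p 0) - w₀‖ * Real.exp (-c ^ 2 * s) := by
  have sub : ∀ t ∈ Icc 0 s, t ∈ Ico 0 T := fun t ht => ⟨ht.1, ht.2.trans_lt hs.2⟩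
  have hderiv : ∀ t ∈ Ico 0 s, HasDerivWithinAt (fun t => ‖F (p t) - w₀‖ ^ 2)
      (-2 * ‖residualFlow F w₀ (p t)‖ ^ 2) (Ici t) t := by
    intro t ht
    have ht' := sub t ⟨ht.1, ht.2.le⟩
    have h1 := ((hF _ (hU t ht')).hasFDerivAt.comp_hasDerivWithinAt t (hp' t ht')).sub_const w₀
    have h2 := h1.norm_sq
    refine h2.congr_deriv ?_
    rw [← ContinuousLinearMap.adjoint_inner_left]
    have : ContinuousLinearMap.adjoint (fderiv ℝ F (p t)) (F (p t) - w₀)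
      = - residualFlow F w₀ (p t) := by simp [residualFlow]
    rw [Function.comp_apply, this, inner_neg_left, real_inner_self_eq_norm_sq]; ring
  have hcont : ContinuousOn (fun t => ‖F (p t) - w₀‖ ^ 2) (Icc 0 s) := by
    intro t ht
    have ht' := sub t ht
    have h1 := (hF _ (hU t ht')).continuousAt.comp_continuousWithinAt
      ((hp t ⟨ht'.1, ht'.2.le⟩).mono (Icc_subset_Icc_right hs.2.le))
    exact (h1.sub continuousWithinAt_const).norm.pow 2
  have := le_gronwallBound_of_liminf_deriv_right_le (K := -2 * c ^ 2) (ε := 0) hcont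
    (fun t ht r hr => by
      simpa [slope_def_field, div_eq_inv_mul] using (hderiv t ht).liminf_right_slope_le hr) le_rfl
    (fun t ht => by
      have h := hPL _ (hU t (sub t ⟨ht.1, ht.2.le⟩))
      have : (c * ‖F (p t) - w₀‖) ^ 2 ≤ ‖residualFlow F w₀ (p t)‖ ^ 2 := by gcongr
      nlinarith) s ⟨hs.1, le_rfl⟩
  rw [gronwallBound_ε0, sub_zero] at this
  refine le_of_sq_le_sq ?_ (by positivity)
  rw [mul_pow, ← Real.exp_nat_mul]
  have h2 : ((2 : ℕ) : ℝ) * (-c ^ 2 * s) = -2 * c ^ 2 * s := by push_cast; ring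
  rwa [h2]

/-- The speed is at most `M` times the residual; integrating the exponential bound on the residual
over `[s, t]` bounds the distance travelled. -/
theorem norm_sub_le_of_gradient_dominated (hF : ∀ x ∈ U, DifferentiableAt ℝ F x)
    (hM : ∀ x ∈ U, ‖fderiv ℝ F x‖ ≤ M) (hM0 : 0 ≤ M)
    (hPL : ∀ x ∈ U, c * ‖F x - w₀‖ ≤ ‖residualFlow F w₀ x‖) (hc : 0 < c)
    {p : ℝ → E} {T : ℝ} (hp : ContinuousOn p (Icc 0 T))
    (hp' : ∀ t ∈ Ico 0 T, HasDerivWithinAt p (residualFlow F w₀ (p t)) (Ici t) t)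
    (hU : ∀ t ∈ Ico 0 T, p t ∈ U) {s t : ℝ} (hs : 0 ≤ s) (hst : s ≤ t) (ht : t ≤ T) :
    ‖p t - p s‖ ≤ M * ‖F (p 0) - w₀‖ / c ^ 2 *
      (Real.exp (-c ^ 2 * s) - Real.exp (-c ^ 2 * t)) := by
  have hc2 : c ^ 2 ≠ 0 := by positivity
  set A := M * ‖F (p 0) - w₀‖ with hA
  have hB : ∀ x, HasDerivAt (fun x => A / c ^ 2 *
      (Real.exp (-c ^ 2 * s) - Real.exp (-c ^ 2 * x))) (A * Real.exp (-c ^ 2 * x)) x := by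
    intro x
    have := ((((hasDerivAt_id x).const_mul (-c ^ 2)).exp).const_sub
      (Real.exp (-c ^ 2 * s))).const_mul (A / c ^ 2)
    refine this.congr_deriv ?_
    field_simp
    simp
  have := image_norm_le_of_norm_deriv_right_le_deriv_boundary' (a := s) (b := t)
    (f := fun x => p x - p s) (f' := fun x => residualFlow F w₀ (p x))
    ((hp.mono (Icc_subset_Icc hs ht)).sub continuousOn_const)
    (fun x hx => (hp' x ⟨hs.trans hx.1, hx.2.trans_le ht⟩).sub_const _)
    (B := fun x => A / c ^ 2 * (Real.exp (-c ^ 2 * s) - Real.exp (-c ^ 2 * x)))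
    (B' := fun x => A * Real.exp (-c ^ 2 * x)) (by simp)
    (fun x _ => (hB x).continuousAt.continuousWithinAt)
    (fun x _ => (hB x).hasDerivWithinAt)
    (fun x hx => by
      have hx' : x ∈ Ico 0 T := ⟨hs.trans hx.1, hx.2.trans_le ht⟩
      have h1 := norm_residual_le_of_gradient_dominated hF hPL hc hp hp' hU hx'
      calc ‖residualFlow F w₀ (p x)‖
          ≤ ‖ContinuousLinearMap.adjoint (fderiv ℝ F (p x))‖ * ‖F (p x) - w₀‖ := by
            rw [residualFlow, norm_neg]; exact ContinuousLinearMap.le_opNorm _ _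
        _ ≤ M * (‖F (p 0) - w₀‖ * Real.exp (-c ^ 2 * x)) := by
            rw [LinearIsometryEquiv.norm_map]
            exact mul_le_mul (hM _ (hU x hx')) h1 (norm_nonneg _) hM0
        _ = A * Real.exp (-c ^ 2 * x) := by rw [hA]; ring)
  exact this ⟨hst, le_rfl⟩

/-- The start is within `r / 2` of the centre and the length of the path is below `r / 2`, so there
is no first exit time. The field `g` need only agree with the flow inside the ball, which admits
truncated fields. -/
theorem mem_ball_of_gradient_dominated {x₀ : E} {r : ℝ}
    (hF : ∀ x ∈ Metric.ball x₀ r, DifferentiableAt ℝ F x)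
    (hM : ∀ x ∈ Metric.ball x₀ r, ‖fderiv ℝ F x‖ ≤ M) (hM0 : 0 ≤ M)
    (hPL : ∀ x ∈ Metric.ball x₀ r, c * ‖F x - w₀‖ ≤ ‖residualFlow F w₀ x‖) (hc : 0 < c)
    {g : E → E} (hg : ∀ x ∈ Metric.ball x₀ r, g x = residualFlow F w₀ x)
    {p : ℝ → E} (hp : IsIntegralCurveOn p (fun _ => g) (Ici 0))
    (h0 : dist (p 0) x₀ < r / 2) (h1 : M * ‖F (p 0) - w₀‖ / c ^ 2 < r / 2)
    {t : ℝ} (ht : 0 ≤ t) : p t ∈ Metric.ball x₀ r := by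
  by_contra hcon
  have hpc : ContinuousOn p (Ici 0) := hp.continuousOn
  set Z := {s ∈ Icc 0 t | r ≤ dist (p s) x₀} with hZ
  have hZne : Z.Nonempty := ⟨t, ⟨ht, le_rfl⟩, by simpa using hcon⟩
  have hZc : IsCompact Z := by
    have : IsClosed Z := by
      have hcd : ContinuousOn (fun s => dist (p s) x₀) (Icc 0 t) :=
        continuous_dist.comp_continuousOn
          ((hpc.mono Icc_subset_Ici_self).prodMk continuousOn_const)
      exact hcd.preimage_isClosed_of_isClosed isClosed_Icc isClosed_Ici
    exact isCompact_Icc.of_isClosed_subset this (fun s hs => hs.1)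
  obtain ⟨T, hT, hTmin⟩ := hZc.exists_isLeast hZne
  have hU : ∀ s ∈ Ico 0 T, p s ∈ Metric.ball x₀ r := by
    intro s hs
    by_contra h
    exact absurd (hTmin ⟨⟨hs.1, hs.2.le.trans hT.1.2⟩, by simpa using h⟩) (not_le.2 hs.2)
  have h2 := norm_sub_le_of_gradient_dominated hF hM hM0 hPL hc (T := T)
    (hpc.mono Icc_subset_Ici_self)
    (fun s hs => by
      rw [← hg _ (hU s hs)]
      exact (hp s hs.1).mono (Ici_subset_Ici.2 hs.1)) hU le_rfl hT.1.1 le_rfl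
  have h3 : M * ‖F (p 0) - w₀‖ / c ^ 2 * (Real.exp (-c ^ 2 * 0) - Real.exp (-c ^ 2 * T)) ≤
      M * ‖F (p 0) - w₀‖ / c ^ 2 * 1 := by
    gcongr
    simp [Real.exp_nonneg]
  have h4 := dist_triangle (p T) (p 0) x₀
  rw [dist_eq_norm (p T) (p 0)] at h4
  linarith [hT.2]

/-- The tail of the path after time `s` has length at most a multiple of `exp (-c² s)`. This gives
both the Cauchy property and the rate, and the limit has zero residual by continuity. -/
theorem exists_limit_of_gradient_dominated {x₀ : E} {r : ℝ}
    (hF : ∀ x ∈ Metric.ball x₀ r, DifferentiableAt ℝ F x)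
    (hM : ∀ x ∈ Metric.ball x₀ r, ‖fderiv ℝ F x‖ ≤ M) (hM0 : 0 ≤ M)
    (hPL : ∀ x ∈ Metric.ball x₀ r, c * ‖F x - w₀‖ ≤ ‖residualFlow F w₀ x‖) (hc : 0 < c)
    {p : ℝ → E} (hp : IsIntegralCurveOn p (fun _ => residualFlow F w₀) (Ici 0))
    (h0 : dist (p 0) x₀ < r / 2) (h1 : M * ‖F (p 0) - w₀‖ / c ^ 2 < r / 2) :
    ∃ y ∈ Metric.ball x₀ r, F y = w₀ ∧
      ∀ t, 0 ≤ t → ‖p t - y‖ ≤ r / 2 * Real.exp (-c ^ 2 * t) := by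
  have hU : ∀ t, 0 ≤ t → p t ∈ Metric.ball x₀ r := fun t ht =>
    mem_ball_of_gradient_dominated hF hM hM0 hPL hc (fun _ _ => rfl) hp h0 h1 ht
  have hpc : ContinuousOn p (Ici 0) := hp.continuousOn
  have hp' : ∀ t, 0 ≤ t → HasDerivWithinAt p (residualFlow F w₀ (p t)) (Ici t) t :=
    fun t ht => (hp t ht).mono (Ici_subset_Ici.2 ht)
  set A := M * ‖F (p 0) - w₀‖ / c ^ 2 with hA
  have hA0 : 0 ≤ A := by positivity
  have hdist : ∀ s t, 0 ≤ s → s ≤ t → ‖p t - p s‖ ≤ A * Real.exp (-c ^ 2 * s) := by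
    intro s t hs hst
    refine (norm_sub_le_of_gradient_dominated hF hM hM0 hPL hc (T := t)
      (hpc.mono Icc_subset_Ici_self) (fun s hs => hp' s hs.1) (fun s hs => hU s hs.1)
      hs hst le_rfl).trans ?_
    gcongr
    linarith [Real.exp_nonneg (-c ^ 2 * t)]
  have hres : ∀ t, 0 ≤ t → ‖F (p t) - w₀‖ ≤ ‖F (p 0) - w₀‖ * Real.exp (-c ^ 2 * t) :=
    fun t ht => norm_residual_le_of_gradient_dominated hF hPL hc (T := t + 1)
      (hpc.mono Icc_subset_Ici_self) (fun s hs => hp' s hs.1) (fun s hs => hU s hs.1)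
      ⟨ht, by linarith⟩
  have hexp : Tendsto (fun t : ℝ => Real.exp (-c ^ 2 * t)) atTop (𝓝 0) := by
    refine Real.tendsto_exp_atBot.comp ?_
    exact tendsto_id.const_mul_atTop_of_neg (by nlinarith)
  have hcauchy : CauchySeq p := by
    rw [Metric.cauchySeq_iff']
    intro ε hε
    have : Tendsto (fun t : ℝ => A * Real.exp (-c ^ 2 * t)) atTop (𝓝 0) := by
      simpa using hexp.const_mul A
    obtain ⟨N, hN, hN0⟩ := ((this.eventually (gt_mem_nhds hε)).and (eventually_ge_atTop 0)).exists
    exact ⟨N, fun t ht => by rw [dist_eq_norm]; exact (hdist N t hN0 ht).trans_lt hN⟩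
  obtain ⟨y, hy⟩ := cauchySeq_tendsto_of_complete hcauchy
  have hlim : ∀ s, 0 ≤ s → ‖p s - y‖ ≤ A * Real.exp (-c ^ 2 * s) := by
    intro s hs
    rw [norm_sub_rev]
    exact le_of_tendsto (hy.sub_const (p s)).norm
      ((eventually_ge_atTop s).mono fun t ht => hdist s t hs ht)
  have hyU : y ∈ Metric.ball x₀ r := by
    have h2 := hlim 0 le_rfl
    have h3 := dist_triangle y (p 0) x₀
    rw [dist_comm y (p 0), dist_eq_norm (p 0) y] at h3
    simp only [mul_zero, Real.exp_zero, mul_one] at h2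
    exact Metric.mem_ball.2 (by linarith)
  refine ⟨y, hyU, ?_, fun t ht => (hlim t ht).trans (by gcongr)⟩
  have h5 : Tendsto (fun t => ‖F (p t) - w₀‖) atTop (𝓝 ‖F y - w₀‖) :=
    (((hF y hyU).continuousAt.tendsto.comp hy).sub_const w₀).norm
  have h6 : Tendsto (fun t : ℝ => ‖F (p 0) - w₀‖ * Real.exp (-c ^ 2 * t)) atTop (𝓝 0) := by
    simpa using hexp.const_mul ‖F (p 0) - w₀‖
  have h7 := le_of_tendsto_of_tendsto h5 h6 ((eventually_ge_atTop 0).mono hres)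
  exact sub_eq_zero.1 (norm_le_zero_iff.1 h7)

theorem contDiffAt_residualFlow {x : E} (hF : ContDiffAt ℝ 2 F x) :
    ContDiffAt ℝ 1 (residualFlow F w₀) x := by
  have h1 : ContDiffAt ℝ 1 (fderiv ℝ F) x := hF.fderiv_right (by norm_num)
  have h2 : ContDiffAt ℝ 1 (fun x => ContinuousLinearMap.adjoint (fderiv ℝ F x)) x :=
    (ContinuousLinearMap.adjoint (𝕜 := ℝ) (E := E) (F := W)).toContinuousLinearEquiv.contDiff
      |>.contDiffAt.comp x h1
  exact (h2.clm_apply ((hF.of_le (by norm_num)).sub contDiffAt_const)).neg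

variable [FiniteDimensional ℝ E]

/-- Local exponential convergence of the gradient flow of `½ ‖F x - w₀‖²` under a gradient
domination (Polyak–Łojasiewicz) inequality. -/
theorem exists_nhds_exponentially_convergent {χ ψ : Set E} {x₀ : E} (hχ : IsOpen χ)
    (hF : ∀ x ∈ χ, ContDiffAt ℝ 2 F x) (hx₀ : x₀ ∈ χ) (hFx₀ : F x₀ = w₀) (hc : 0 < c)
    (hPL : ∀ᶠ x in 𝓝 x₀, c * ‖F x - w₀‖ ≤ ‖residualFlow F w₀ x‖)
    (hψ : ∀ᶠ x in 𝓝 x₀, F x = w₀ → x ∈ ψ) :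
    ∃ B ∈ 𝓝 x₀, ∃ C > (0 : ℝ), ∃ γ > (0 : ℝ), ∀ y₀ ∈ B,
      (∃ p : ℝ → E, (IsIntegralCurveOn p (fun _ => residualFlow F w₀) (Ici 0) ∧
        ∀ t, 0 ≤ t → p t ∈ χ) ∧ p 0 = y₀) ∧
      ∀ p : ℝ → E, (IsIntegralCurveOn p (fun _ => residualFlow F w₀) (Ici 0)) → p 0 = y₀ →
        ∃ y ∈ ψ, ∀ t, 0 ≤ t → ‖p t - y‖ ≤ C * Real.exp (-γ * t) := by
  have hfd : ContinuousAt (fun x => ‖fderiv ℝ F x‖) x₀ :=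
    ((hF x₀ hx₀).fderiv_right (m := 1) (by norm_num)).continuousAt.norm
  have hMev : ∀ᶠ x in 𝓝 x₀, ‖fderiv ℝ F x‖ ≤ ‖fderiv ℝ F x₀‖ + 1 :=
    (hfd.eventually (gt_mem_nhds (lt_add_one _))).mono fun _ h => le_of_lt h
  obtain ⟨R, hR, hball⟩ := Metric.eventually_nhds_iff_ball.1
    ((hPL.and hψ).and (hMev.and (hχ.mem_nhds hx₀)))
  set M := ‖fderiv ℝ F x₀‖ + 1 with hMdef
  have hM0 : 0 ≤ M := by positivity
  set r := R / 2 with hr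
  have hr0 : 0 < r := by positivity
  have hrR : r < R := by linarith
  have sub : Metric.ball x₀ r ⊆ Metric.ball x₀ R := Metric.ball_subset_ball hrR.le
  have hF' : ∀ x ∈ Metric.ball x₀ r, DifferentiableAt ℝ F x := fun x hx =>
    (hF x (hball x (sub hx)).2.2).differentiableAt (by norm_num)
  have hM' : ∀ x ∈ Metric.ball x₀ r, ‖fderiv ℝ F x‖ ≤ M := fun x hx => (hball x (sub hx)).2.1
  have hPL' : ∀ x ∈ Metric.ball x₀ r, c * ‖F x - w₀‖ ≤ ‖residualFlow F w₀ x‖ :=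
    fun x hx => (hball x (sub hx)).1.1
  -- Cutting the flow off outside the ball of radius `r` yields a compactly supported C¹ field,
  -- hence a bounded and globally Lipschitz one, with global solutions. Those starting in the chosen
  -- neighbourhood never reach the region where the field was changed.
  let b : ContDiffBump x₀ := ⟨r, (r + R) / 2, hr0, by linarith⟩
  have hb : tsupport b ⊆ Metric.ball x₀ R := by
    rw [b.tsupport_eq]
    exact Metric.closedBall_subset_ball (by change (r + R) / 2 < R; linarith)
  set g : E → E := fun x => b x • residualFlow F w₀ x with hgdef
  have hg : ∀ x ∈ Metric.ball x₀ r, g x = residualFlow F w₀ x := by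
    intro x hx
    simp [hgdef, b.one_of_mem_closedBall (Metric.ball_subset_closedBall hx)]
  have hgc : HasCompactSupport g := b.hasCompactSupport.smul_right
  have hgd : ContDiff ℝ 1 g := by
    rw [contDiff_iff_contDiffAt]
    intro x
    by_cases hx : x ∈ tsupport b
    · exact (b.contDiff.contDiffAt).smul (contDiffAt_residualFlow (hF x (hball x (hb hx)).2.2))
    · have : g =ᶠ[𝓝 x] fun _ => 0 := by
        filter_upwards [notMem_tsupport_iff_eventuallyEq.1 hx] with y hy
        simp [hgdef, hy]
      exact contDiffAt_const.congr_of_eventuallyEq this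
  obtain ⟨K, hK⟩ := hgd.lipschitzWith_of_hasCompactSupport hgc (by norm_num)
  obtain ⟨L, hL⟩ := hgc.exists_bound_of_continuous hgd.continuous
  have hsmall : ∀ᶠ x in 𝓝 x₀, M * ‖F x - w₀‖ / c ^ 2 < r / 2 := by
    have : ContinuousAt (fun x => M * ‖F x - w₀‖ / c ^ 2) x₀ :=
      ((continuousAt_const.mul ((hF x₀ hx₀).continuousAt.sub continuousAt_const).norm)).div_const _
    refine this.eventually (gt_mem_nhds ?_)
    simp [hFx₀, hr0]
  -- The two conditions are the hypotheses of the confinement lemma; the second holds near `x₀`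
  -- because the residual vanishes there.
  refine ⟨{x | dist x x₀ < r / 2 ∧ M * ‖F x - w₀‖ / c ^ 2 < r / 2},
    inter_mem (Metric.ball_mem_nhds x₀ (half_pos hr0)) hsmall,
    r / 2, half_pos hr0, c ^ 2, by positivity, ?_⟩
  rintro y₀ ⟨hy1, hy2⟩
  refine ⟨?_, ?_⟩
  · obtain ⟨p, hp0, hp⟩ := exists_isIntegralCurveOn_Ici hK (L := L.toNNReal)
      (fun x => (hL x).trans (Real.le_coe_toNNReal L)) y₀
    subst hp0
    have hin : ∀ t, 0 ≤ t → p t ∈ Metric.ball x₀ r := fun t ht =>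
      mem_ball_of_gradient_dominated hF' hM' hM0 hPL' hc hg hp hy1 hy2 ht
    refine ⟨p, ⟨fun t ht => ?_, fun t ht => (hball _ (sub (hin t ht))).2.2⟩, rfl⟩
    have := hp t ht
    simp only [hg _ (hin t ht)] at this
    exact this
  · rintro p hp rfl
    obtain ⟨y, hy, hFy, hlim⟩ :=
      exists_limit_of_gradient_dominated hF' hM' hM0 hPL' hc hp hy1 hy2
    exact ⟨y, (hball y (sub hy)).1.2 hFy, hlim⟩

end GradientFlow

/-! ### Gradient domination transverse to the kernel of the derivative -/

section GradientDomination

variable {E W : Type*} [NormedAddCommGroup E] [InnerProductSpace ℝ E] [FiniteDimensional ℝ E]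
  [NormedAddCommGroup W] [InnerProductSpace ℝ W]

/-- `L` is injective on the orthogonal complement of its kernel, and an injective linear map on a
finite-dimensional space is bounded below. -/
theorem exists_le_norm_of_mem_ker_orthogonal (L : E →L[ℝ] W) :
    ∃ a > 0, ∀ w ∈ (LinearMap.ker (L : E →ₗ[ℝ] W))ᗮ, a * ‖w‖ ≤ ‖L w‖ := by
  set N := LinearMap.ker (L : E →ₗ[ℝ] W)
  have hker : LinearMap.ker ((L : E →ₗ[ℝ] W) ∘ₗ Nᗮ.subtype) = ⊥ := by
    rw [LinearMap.ker_eq_bot']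
    intro w hw
    have h1 : (w : E) ∈ N := hw
    exact Subtype.ext (inner_self_eq_zero.1 (w.2 _ h1 : inner ℝ (w : E) (w : E) = 0))
  obtain ⟨K, hK, hL⟩ := LinearMap.exists_antilipschitzWith _ hker
  have hK' : (0 : ℝ) < K := hK
  refine ⟨(K : ℝ)⁻¹, inv_pos.2 hK', fun w hw => ?_⟩
  have := hL.le_mul_dist ⟨w, hw⟩ 0
  rw [map_zero, dist_zero_right, dist_zero_right] at this
  rw [inv_mul_le_iff₀ hK']
  exact this

variable [CompleteSpace W]

/-- The gradient domination inequality on a slice transverse to the kernel of the derivative. -/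
theorem gradient_dominated_on_slice {F : E → W} {q : E} (hF : ContDiffAt ℝ 1 F q)
    {N : Set E} {a : ℝ} (ha : 0 < a) (hN : ∀ w ∈ N, a * ‖w‖ ≤ ‖fderiv ℝ F q w‖) :
    ∃ δ > 0, ∀ x, ‖x - q‖ < δ → x - q ∈ N →
      a / 2 * ‖x - q‖ ≤ ‖F x - F q‖ ∧
      a / 4 * ‖F x - F q‖ ≤ ‖residualFlow F (F q) x‖ := by
  -- Linearizing at `q` and replacing the derivative at `q` by the one at `x` each cost `a / 8`,
  -- together the `a / 4` of `h6`.
  have h1 : ∀ᶠ x in 𝓝 q, ‖F x - F q - fderiv ℝ F q (x - q)‖ ≤ a / 8 * ‖x - q‖ :=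
    (hF.differentiableAt (by norm_num)).hasFDerivAt.isLittleO.bound (by positivity)
  have h2 : ∀ᶠ x in 𝓝 q, ‖fderiv ℝ F x - fderiv ℝ F q‖ < a / 8 := by
    have : ContinuousAt (fderiv ℝ F) q := (hF.fderiv_right (m := 0) (by norm_num)).continuousAt
    simpa [dist_eq_norm] using this.eventually (Metric.ball_mem_nhds _ (by positivity))
  obtain ⟨δ, hδ, h⟩ := Metric.eventually_nhds_iff_ball.1 (h1.and h2)
  refine ⟨δ, hδ, fun x hx hxN => ?_⟩
  obtain ⟨h1, h2⟩ := h x (by simpa [dist_eq_norm] using hx)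
  set w := x - q
  set e := F x - F q
  have h3 := hN w hxN
  have h4 : ‖fderiv ℝ F q w‖ ≤ ‖e‖ + ‖e - fderiv ℝ F q w‖ := by
    have := norm_sub_le e (e - fderiv ℝ F q w)
    simpa using this
  have hw := norm_nonneg w
  have h5 : a / 2 * ‖w‖ ≤ ‖e‖ := by nlinarith
  refine ⟨h5, ?_⟩
  rcases hw.eq_or_lt with hw0 | hw0
  · have hxq : x = q := sub_eq_zero.1 (norm_eq_zero.1 hw0.symm)
    have : e = 0 := by simp [e, hxq]
    rw [this]; simp
  have h6 : ‖fderiv ℝ F x w - e‖ ≤ a / 4 * ‖w‖ := by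
    have h7 : fderiv ℝ F x w - e = (fderiv ℝ F x - fderiv ℝ F q) w - (e - fderiv ℝ F q w) := by
      rw [_root_.sub_apply]; abel
    have h8 := (fderiv ℝ F x - fderiv ℝ F q).le_of_opNorm_le h2.le w
    rw [h7]
    linarith [norm_sub_le ((fderiv ℝ F x - fderiv ℝ F q) w) (e - fderiv ℝ F q w)]
  -- Test the gradient against `w`: since `fderiv ℝ F x w` is close to `e`, the pairing is at least
  -- `‖e‖ * (‖e‖ - a / 4 * ‖w‖)`, hence at least `a / 4 * ‖e‖ * ‖w‖` by `h5`. Cauchy–Schwarz bounds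
  -- it above, and `‖w‖` cancels.
  have h9 : ‖e‖ ^ 2 - ‖e‖ * (a / 4 * ‖w‖) ≤ inner ℝ e (fderiv ℝ F x w) := by
    have : inner ℝ e (fderiv ℝ F x w) = ‖e‖ ^ 2 + inner ℝ e (fderiv ℝ F x w - e) := by
      rw [inner_sub_right, real_inner_self_eq_norm_sq]; ring
    rw [this]
    have h10 := (abs_le.1 (abs_real_inner_le_norm e (fderiv ℝ F x w - e))).1
    have := mul_le_mul_of_nonneg_left h6 (norm_nonneg e)
    linarith
  have h11 : inner ℝ e (fderiv ℝ F x w) ≤ ‖residualFlow F (F q) x‖ * ‖w‖ := by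
    rw [← ContinuousLinearMap.adjoint_inner_left, residualFlow, norm_neg]
    exact real_inner_le_norm _ _
  have h12 : a / 4 * ‖e‖ * ‖w‖ ≤ ‖residualFlow F (F q) x‖ * ‖w‖ := by
    nlinarith [norm_nonneg e]
  exact le_of_mul_le_mul_right h12 hw0

/-- Equivariance of the gradient flow under an isometry that leaves `F` invariant. -/
theorem norm_residualFlow_of_invariant {F : E → W} {w₀ : W} (A : E ≃ₗᵢ[ℝ] E) (b : E)
    (h : ∀ x, F (A x + b) = F x) (x : E) :
    ‖residualFlow F w₀ (A x + b)‖ = ‖residualFlow F w₀ x‖ := by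
  have h1 : fderiv ℝ F x =
      (fderiv ℝ F (A x + b)).comp (A.toContinuousLinearEquiv : E →L[ℝ] E) := by
    have h2 : F = (fun y => F (y + b)) ∘ A.toContinuousLinearEquiv := by
      funext y; exact (h y).symm
    conv_lhs => rw [h2]
    rw [ContinuousLinearEquiv.comp_right_fderiv, fderiv_comp_add_right]
    rfl
  rw [residualFlow, residualFlow, norm_neg, norm_neg, h, h1, ContinuousLinearMap.adjoint_comp,
    ContinuousLinearMap.comp_apply]
  set u := ContinuousLinearMap.adjoint (fderiv ℝ F (A x + b)) (F x - w₀)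
  have h3 : ContinuousLinearMap.adjoint (A.toContinuousLinearEquiv : E →L[ℝ] E) u = A.symm u := by
    refine ext_inner_right ℝ fun v => ?_
    rw [ContinuousLinearMap.adjoint_inner_left]
    have := A.inner_map_map (A.symm u) v
    simpa using this
  rw [h3, LinearIsometryEquiv.norm_map]

end GradientDomination

/-! ### Rigid motions and the closest point on an orbit -/

section RigidMotion

variable {d n : ℕ}

/-- The matrix `Q` applied to all positions. -/
def rotate (Q : Matrix (Fin d) (Fin d) ℝ) : Config d n →ₗ[ℝ] Config d n where
  toFun p := WithLp.toLp 2 fun x => (Q *ᵥ (pos p x.1).ofLp) x.2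
  map_add' p r := by
    ext x
    exact congrFun (Matrix.mulVec_add Q (pos p x.1).ofLp (pos r x.1).ofLp) x.2
  map_smul' c p := by
    ext x
    exact congrFun (Matrix.mulVec_smul Q c (pos p x.1).ofLp) x.2

/-- The translation vector `b` at all positions. -/
def translate : (Fin d → ℝ) →ₗ[ℝ] Config d n where
  toFun b := WithLp.toLp 2 fun x => b x.2
  map_add' _ _ := rfl
  map_smul' _ _ := rfl

theorem Config.ext_pos {p r : Config d n} (h : ∀ i, (pos p i).ofLp = (pos r i).ofLp) : p = r := by
  ext x
  exact congrFun (h x.1) x.2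

theorem pos_add (p r : Config d n) (i : Fin n) : pos (p + r) i = pos p i + pos r i := rfl

theorem pos_rotate (Q : Matrix (Fin d) (Fin d) ℝ) (p : Config d n) (i : Fin n) :
    (pos (rotate Q p) i).ofLp = Q *ᵥ (pos p i).ofLp := rfl

theorem pos_rotate_add_translate (Q : Matrix (Fin d) (Fin d) ℝ) (b : Fin d → ℝ)
    (p : Config d n) (i : Fin n) :
    (pos (rotate Q p + translate b) i).ofLp = Q *ᵥ (pos p i).ofLp + b := rfl

theorem rotate_one (p : Config d n) : rotate 1 p = p :=
  Config.ext_pos fun i => by rw [pos_rotate, one_mulVec]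

theorem rotate_mul (P Q : Matrix (Fin d) (Fin d) ℝ) (p : Config d n) :
    rotate (P * Q) p = rotate P (rotate Q p) :=
  Config.ext_pos fun i => by simp only [pos_rotate, mulVec_mulVec]

theorem rotate_translate (Q : Matrix (Fin d) (Fin d) ℝ) (b : Fin d → ℝ) :
    rotate Q (translate b : Config d n) = translate (Q *ᵥ b) := rfl

theorem rotate_neg (Q : Matrix (Fin d) (Fin d) ℝ) (p : Config d n) :
    rotate (-Q) p = -rotate Q p :=
  Config.ext_pos fun i => by rw [pos_rotate, neg_mulVec]; rfl

theorem inner_eq_sum_pos (p r : Config d n) :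
    inner ℝ p r = ∑ i, (pos p i).ofLp ⬝ᵥ (pos r i).ofLp := by
  simp [PiLp.inner_apply, Fintype.sum_prod_type, dotProduct, pos, mul_comm]

theorem inner_rotate (Q : Matrix (Fin d) (Fin d) ℝ) (p r : Config d n) :
    inner ℝ (rotate Q p) r = inner ℝ p (rotate Qᵀ r) := by
  simp only [inner_eq_sum_pos, pos_rotate]
  refine Finset.sum_congr rfl fun i _ => ?_
  rw [dotProduct_mulVec, vecMul_transpose]

theorem inner_rotate_self_of_skew {A : Matrix (Fin d) (Fin d) ℝ} (hA : Aᵀ = -A)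
    (p : Config d n) : inner ℝ p (rotate A p) = 0 := by
  have h := inner_rotate A p p
  rw [hA, rotate_neg, inner_neg_right, real_inner_comm] at h
  linarith

theorem mem_specialOrthogonalGroup {Q : Matrix (Fin d) (Fin d) ℝ} :
    Q ∈ Matrix.specialOrthogonalGroup (Fin d) ℝ ↔ Q * Qᵀ = 1 ∧ Q.det = 1 := by
  rw [Matrix.mem_specialOrthogonalGroup_iff, Matrix.mem_orthogonalGroup_iff]

theorem transpose_mem_specialOrthogonalGroup {Q : Matrix (Fin d) (Fin d) ℝ}
    (hQ : Q ∈ Matrix.specialOrthogonalGroup (Fin d) ℝ) :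
    Qᵀ ∈ Matrix.specialOrthogonalGroup (Fin d) ℝ := by
  rw [mem_specialOrthogonalGroup] at hQ ⊢
  exact ⟨by rw [transpose_transpose]; exact mul_eq_one_comm.1 hQ.1, by rw [det_transpose, hQ.2]⟩

theorem norm_rotate {Q : Matrix (Fin d) (Fin d) ℝ}
    (hQ : Q ∈ Matrix.specialOrthogonalGroup (Fin d) ℝ) (p : Config d n) :
    ‖rotate Q p‖ = ‖p‖ := by
  have h := inner_rotate Q p (rotate Q p)
  rw [← rotate_mul, mul_eq_one_comm.1 (mem_specialOrthogonalGroup.1 hQ).1, rotate_one,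
    real_inner_self_eq_norm_sq, real_inner_self_eq_norm_sq] at h
  exact (sq_eq_sq₀ (norm_nonneg _) (norm_nonneg _)).1 h

/-- A rotation of the formation as a linear isometric equivalence. -/
def rotateIsometry (Q : Matrix (Fin d) (Fin d) ℝ)
    (hQ : Q ∈ Matrix.specialOrthogonalGroup (Fin d) ℝ) : Config d n ≃ₗᵢ[ℝ] Config d n :=
  LinearIsometry.toLinearIsometryEquiv ⟨rotate Q, norm_rotate hQ⟩ rfl

theorem isCompact_specialOrthogonalGroup :
    IsCompact (Matrix.specialOrthogonalGroup (Fin d) ℝ : Set (Matrix (Fin d) (Fin d) ℝ)) := by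
  have hK : IsCompact (Set.pi univ fun _ : Fin d => Set.pi univ fun _ : Fin d =>
      Icc (-1 : ℝ) 1) :=
    isCompact_univ_pi fun _ => isCompact_univ_pi fun _ => isCompact_Icc
  refine hK.of_isClosed_subset ?_ ?_
  · have : (Matrix.specialOrthogonalGroup (Fin d) ℝ : Set (Matrix (Fin d) (Fin d) ℝ)) =
        {Q | Q * Qᵀ = 1} ∩ {Q | Q.det = 1} := by
      ext Q; exact mem_specialOrthogonalGroup
    rw [this]
    exact (isClosed_eq (by fun_prop) continuous_const).inter
      (isClosed_eq (by fun_prop) continuous_const)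
  · intro Q hQ i _ j _
    have h : ∑ k, Q i k * Q i k = 1 :=
      (congrFun (congrFun (mem_specialOrthogonalGroup.1 hQ).1 i) i).trans (Matrix.one_apply_eq i)
    have h2 : Q i j * Q i j ≤ 1 := by
      rw [← h]
      exact Finset.single_le_sum (f := fun j => Q i j * Q i j)
        (fun k _ => mul_self_nonneg (Q i k)) (Finset.mem_univ j)
    exact abs_le.1 (abs_le_one_iff_mul_self_le_one.2 h2)

/-- Among all rigid motions of `p` there is one that is closest to `q`. -/
theorem exists_closest_rigid_motion (p q : Config d n) :
    ∃ Q ∈ Matrix.specialOrthogonalGroup (Fin d) ℝ, ∃ b : Fin d → ℝ,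
      ∀ Q' ∈ Matrix.specialOrthogonalGroup (Fin d) ℝ, ∀ b' : Fin d → ℝ,
        ‖rotate Q p + translate b - q‖ ≤ ‖rotate Q' p + translate b' - q‖ := by
  set T : Submodule ℝ (Config d n) := LinearMap.range translate
  -- A translation of norm above `R` leaves a distance larger than `‖p - q‖`, which the identity
  -- attains; so a minimum over a compact set is a global one.
  set R := ‖p‖ + ‖q‖ + ‖p - q‖
  have hK : IsCompact ((Matrix.specialOrthogonalGroup (Fin d) ℝ : Set (Matrix (Fin d) (Fin d) ℝ))
      ×ˢ ((T : Set (Config d n)) ∩ Metric.closedBall 0 R)) :=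
    isCompact_specialOrthogonalGroup.prod
      ((isCompact_closedBall 0 R).inter_left T.closed_of_finiteDimensional)
  have hcont : Continuous fun z : Matrix (Fin d) (Fin d) ℝ × Config d n =>
      ‖rotate z.1 p + z.2 - q‖ := by
    have : Continuous fun z : Matrix (Fin d) (Fin d) ℝ × Config d n => rotate z.1 p := by
      refine (PiLp.continuous_toLp 2 _).comp (continuous_pi fun x => ?_)
      simp only [mulVec, dotProduct]
      fun_prop
    fun_prop
  have h1 : (1 : Matrix (Fin d) (Fin d) ℝ) ∈ Matrix.specialOrthogonalGroup (Fin d) ℝ := one_mem _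
  have hmem : ((1 : Matrix (Fin d) (Fin d) ℝ), (0 : Config d n)) ∈
      (Matrix.specialOrthogonalGroup (Fin d) ℝ : Set (Matrix (Fin d) (Fin d) ℝ))
      ×ˢ ((T : Set (Config d n)) ∩ Metric.closedBall 0 R) :=
    ⟨h1, T.zero_mem, Metric.mem_closedBall_self (by positivity)⟩
  obtain ⟨⟨Q, u⟩, ⟨hQ, ⟨b, rfl⟩, _⟩, hmin⟩ := hK.exists_isMinOn ⟨_, hmem⟩ hcont.continuousOn
  refine ⟨Q, hQ, b, fun Q' hQ' b' => ?_⟩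
  rcases le_or_gt ‖(translate b' : Config d n)‖ R with hb | hb
  · exact hmin (a := (Q', translate b')) ⟨hQ', ⟨b', rfl⟩, by simpa using hb⟩
  · refine (hmin hmem).trans ?_
    simp only [rotate_one, add_zero]
    have h2 : ‖(translate b' : Config d n)‖ ≤
        ‖rotate Q' p + translate b' - q‖ + (‖p‖ + ‖q‖) := by
      calc ‖(translate b' : Config d n)‖
          = ‖(rotate Q' p + translate b' - q) - (rotate Q' p - q)‖ := by congr 1; abel
        _ ≤ _ := by
          refine (norm_sub_le _ _).trans ?_
          gcongr
          exact (norm_sub_le _ _).trans_eq (by rw [norm_rotate hQ'])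
    linarith

section Exponential

attribute [local instance] Matrix.linftyOpNormedRing Matrix.linftyOpNormedAlgebra

/-- Orthogonality comes from `exp (-A)` being inverse to `exp A`. The determinant is `1`, not `-1`,
because `exp A` is the square of the orthogonal matrix `exp (A / 2)`. -/
theorem exp_mem_specialOrthogonalGroup {A : Matrix (Fin d) (Fin d) ℝ} (hA : Aᵀ = -A) :
    NormedSpace.exp A ∈ Matrix.specialOrthogonalGroup (Fin d) ℝ := by
  have key : ∀ B : Matrix (Fin d) (Fin d) ℝ, Bᵀ = -B →
      NormedSpace.exp B * (NormedSpace.exp B)ᵀ = 1 := by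
    intro B hB
    rw [← Matrix.exp_transpose, hB,
      ← Matrix.exp_add_of_commute _ _ (Commute.refl B).neg_right, add_neg_cancel,
      NormedSpace.exp_zero]
  have hA2 : ((1 / 2 : ℝ) • A)ᵀ = -((1 / 2 : ℝ) • A) := by rw [transpose_smul, hA, smul_neg]
  have hsq : NormedSpace.exp A =
      NormedSpace.exp ((1 / 2 : ℝ) • A) * NormedSpace.exp ((1 / 2 : ℝ) • A) := by
    rw [← Matrix.exp_add_of_commute _ _ (Commute.refl _), ← add_smul]
    norm_num
  have hdet := congrArg Matrix.det (key _ hA2)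
  rw [det_mul, det_transpose, det_one] at hdet
  exact mem_specialOrthogonalGroup.2 ⟨key A hA, by rw [hsq, det_mul, hdet]⟩

theorem hasDerivAt_rotate_exp (A : Matrix (Fin d) (Fin d) ℝ) (x : Config d n) :
    HasDerivAt (fun t : ℝ => rotate (NormedSpace.exp (t • A)) x) (rotate A x) 0 := by
  let Φ : Matrix (Fin d) (Fin d) ℝ →ₗ[ℝ] Config d n :=
    { toFun := fun Q => rotate Q x
      map_add' := fun P Q => Config.ext_pos fun i => by
        rw [pos_add, pos_rotate, add_mulVec]; rfl
      map_smul' := fun c Q => Config.ext_pos fun i => by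
        rw [pos_rotate, smul_mulVec]; rfl }
  have h := hasDerivAt_exp_smul_const (𝕂 := ℝ) A (0 : ℝ)
  rw [zero_smul, NormedSpace.exp_zero, one_mul] at h
  exact (LinearMap.toContinuousLinearMap Φ).hasFDerivAt.comp_hasDerivAt (0 : ℝ) h

end Exponential

theorem inner_eq_zero_of_forall_norm_le {c : ℝ → Config d n} {c' q : Config d n}
    (hc : HasDerivAt c c' 0) (hmin : ∀ t, ‖c 0 - q‖ ≤ ‖c t - q‖) :
    inner ℝ (c 0 - q) c' = 0 := by
  have h1 := (hc.sub_const q).norm_sq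
  have h2 : IsLocalMin (fun t => ‖c t - q‖ ^ 2) 0 := by
    refine Eventually.of_forall fun t => ?_
    have := hmin t
    dsimp only
    gcongr
  have := h2.hasDerivAt_eq_zero h1
  linarith

/-- If `x` is closest to `q` among its rigid motions, then `x - q` is orthogonal to all trivial
motions of `q`. -/
theorem inner_trivialMotion_eq_zero {x q v : Config d n}
    (hmin : ∀ Q ∈ Matrix.specialOrthogonalGroup (Fin d) ℝ, ∀ b : Fin d → ℝ,
      ‖x - q‖ ≤ ‖rotate Q x + translate b - q‖)
    (hv : IsTrivialMotion q v) : inner ℝ (x - q) v = 0 := by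
  obtain ⟨A, b, hA, hv⟩ := hv
  have hv' : v = rotate A q + translate b := Config.ext_pos hv
  have h1 : inner ℝ (x - q) (rotate A x) = 0 := by
    have := inner_eq_zero_of_forall_norm_le (q := q) (hasDerivAt_rotate_exp A x) (fun t => by
      have := hmin _ (exp_mem_specialOrthogonalGroup (A := t • A)
        (by rw [transpose_smul, hA, smul_neg])) 0
      simpa [rotate_one] using this)
    simpa [rotate_one] using this
  have h2 : inner ℝ (x - q) (translate b) = 0 := by
    have hd : HasDerivAt (fun t : ℝ => x + t • (translate b : Config d n)) (translate b) 0 := by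
      simpa using ((hasDerivAt_id (0 : ℝ)).smul_const (translate b : Config d n)).const_add x
    have := inner_eq_zero_of_forall_norm_le (q := q) hd (fun t => by
      have := hmin 1 (one_mem _) (t • b)
      simpa [rotate_one] using this)
    simpa using this
  -- Minimality gives orthogonality to `rotate A x`, the infinitesimal rotation at `x`. The one at
  -- `q` differs from it by `rotate A (x - q)`, which is orthogonal to `x - q` by skew-symmetry.
  have h3 := inner_rotate_self_of_skew hA (x - q)
  rw [map_sub, inner_sub_right, h1] at h3
  rw [hv', inner_add_right, h2]
  linarith

end RigidMotion

/-! ### The constraint map, its invariance and the local convergence theorem -/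

section Constraints

variable {d n : ℕ} {ι : Type}

/-- The rigidity function with the signed constraints multiplied by the gain `k`. -/
def weightedConstraints (G : SimpleGraph (Fin n)) (s : Config d n → ι → ℝ) (k : ℝ)
    (p : Config d n) : EuclideanSpace ℝ (G.edgeSet ⊕ ι) :=
  WithLp.toLp 2 fun r => Sum.elim (fun _ => 1) (fun _ => k) r * rigidityFunction G s p r

theorem contDiff_pos (i : Fin n) : ContDiff ℝ 2 fun p : Config d n => pos p i := by
  rw [contDiff_euclidean]
  intro a
  exact (EuclideanSpace.proj (i, a) : Config d n →L[ℝ] ℝ).contDiff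

theorem contDiff_halfSqDist (e : Sym2 (Fin n)) :
    ContDiff ℝ 2 fun p : Config d n => halfSqDist p e := by
  induction e with
  | h i j => exact contDiff_const.mul (((contDiff_pos i).sub (contDiff_pos j)).norm_sq ℝ)

variable (G : SimpleGraph (Fin n)) {s : Config d n → ι → ℝ} {k : ℝ} {p : Config d n}

theorem contDiffAt_rigidityFunction (hs : ∀ t, ContDiffAt ℝ 2 (fun x => s x t) p)
    (r : G.edgeSet ⊕ ι) : ContDiffAt ℝ 2 (fun x => rigidityFunction G s x r) p := by
  cases r with
  | inl e => exact (contDiff_halfSqDist e.1).contDiffAt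
  | inr t => exact hs t

theorem rigidityMatrix_mulVec (v : Config d n) (r : G.edgeSet ⊕ ι) :
    (rigidityMatrix G s p *ᵥ v.ofLp) r = fderiv ℝ (fun x => rigidityFunction G s x r) p v := by
  have hv : v = ∑ c, v c • EuclideanSpace.single c (1 : ℝ) := by
    ext x
    simp [Finset.sum_apply, Pi.single_apply]
  conv_rhs => rw [hv]
  simp [mulVec, dotProduct, rigidityMatrix, mul_comm]

variable {Q : Matrix (Fin d) (Fin d) ℝ}

theorem norm_toLp_mulVec (hQ : Q ∈ Matrix.specialOrthogonalGroup (Fin d) ℝ)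
    (v : EuclideanSpace ℝ (Fin d)) : ‖WithLp.toLp 2 (Q *ᵥ v.ofLp)‖ = ‖v‖ := by
  have h : ∀ w : EuclideanSpace ℝ (Fin d), ‖w‖ ^ 2 = w.ofLp ⬝ᵥ w.ofLp := fun w => by
    rw [← real_inner_self_eq_norm_sq, EuclideanSpace.inner_eq_star_dotProduct, star_trivial]
  refine (sq_eq_sq₀ (norm_nonneg _) (norm_nonneg _)).1 ?_
  rw [h, h, dotProduct_mulVec, ← mulVec_transpose, mulVec_mulVec,
    mul_eq_one_comm.1 (mem_specialOrthogonalGroup.1 hQ).1, one_mulVec]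

theorem relPos_rigid_motion (b : Fin d → ℝ) (p : Config d n) (i j : Fin n) :
    relPos (rotate Q p + translate b) i j = WithLp.toLp 2 (Q *ᵥ (relPos p i j).ofLp) := by
  apply WithLp.ofLp_injective
  simp only [relPos, WithLp.ofLp_sub, pos_rotate_add_translate, mulVec_sub]
  abel

/-- Coincident agents need no exclusion, as both sides are then zero. Invariance thus holds on the
whole space, as `norm_residualFlow_of_invariant` demands. -/
theorem bearing_rigid_motion (hQ : Q ∈ Matrix.specialOrthogonalGroup (Fin d) ℝ)
    (b : Fin d → ℝ) (p : Config d n) (i j : Fin n) :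
    (bearing (rotate Q p + translate b) i j).ofLp = Q *ᵥ (bearing p i j).ofLp := by
  rw [bearing, bearing, relPos_rigid_motion, norm_toLp_mulVec hQ, WithLp.ofLp_smul,
    WithLp.ofLp_smul, mulVec_smul]

theorem halfSqDist_rigid_motion (hQ : Q ∈ Matrix.specialOrthogonalGroup (Fin d) ℝ)
    (b : Fin d → ℝ) (p : Config d n) (e : Sym2 (Fin n)) :
    halfSqDist (rotate Q p + translate b) e = halfSqDist p e := by
  induction e with
  | h i j => simp only [halfSqDist, Sym2.lift_mk, relPos_rigid_motion, norm_toLp_mulVec hQ]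

theorem weightedConstraints_rigid_motion
    (hinv : ∀ Q ∈ Matrix.specialOrthogonalGroup (Fin d) ℝ, ∀ (b : Fin d → ℝ) (p : Config d n),
      s (rotate Q p + translate b) = s p)
    (hQ : Q ∈ Matrix.specialOrthogonalGroup (Fin d) ℝ) (b : Fin d → ℝ) (p : Config d n) :
    weightedConstraints G s k (rotate Q p + translate b) = weightedConstraints G s k p := by
  have h : rigidityFunction G s (rotate Q p + translate b) = rigidityFunction G s p := by
    funext r
    cases r with
    | inl e => exact halfSqDist_rigid_motion hQ b p e
    | inr t => exact congrFun (hinv Q hQ b p) t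
  rw [weightedConstraints, h, weightedConstraints]

variable [DecidableRel G.Adj] [Fintype ι]

theorem contDiffAt_weightedConstraints (hs : ∀ t, ContDiffAt ℝ 2 (fun x => s x t) p) :
    ContDiffAt ℝ 2 (weightedConstraints G s k) p :=
  contDiffAt_euclidean.2 fun r => contDiffAt_const.mul (contDiffAt_rigidityFunction G hs r)

theorem fderiv_weightedConstraints_apply (hs : ∀ t, ContDiffAt ℝ 2 (fun x => s x t) p)
    (v : Config d n) (r : G.edgeSet ⊕ ι) :
    fderiv ℝ (weightedConstraints G s k) p v r =
      Sum.elim (fun _ => 1) (fun _ => k) r *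
        fderiv ℝ (fun x => rigidityFunction G s x r) p v := by
  have h1 := ((contDiffAt_weightedConstraints G (k := k) hs).differentiableAt
    (by norm_num)).hasFDerivAt
  have h2 := ((EuclideanSpace.proj r : EuclideanSpace ℝ (G.edgeSet ⊕ ι) →L[ℝ] ℝ).hasFDerivAt.comp p
    h1).fderiv
  have h3 := ((contDiffAt_rigidityFunction G hs r).differentiableAt
    (by norm_num)).hasFDerivAt.const_mul (Sum.elim (fun _ => 1) (fun _ => k) r)
  have h4 := h2.symm.trans h3.fderiv
  exact congrArg (fun L : Config d n →L[ℝ] ℝ => L v) h4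

theorem controlLaw_eq_residualFlow (hs : ∀ t, ContDiffAt ℝ 2 (fun x => s x t) p)
    (q : Config d n) :
    controlLaw G s k q p =
      residualFlow (weightedConstraints G s k) (weightedConstraints G s k q) p := by
  refine ext_inner_right ℝ fun v => ?_
  rw [residualFlow, inner_neg_left, ContinuousLinearMap.adjoint_inner_left]
  have he : formationError G s k q p =
      (weightedConstraints G s k p - weightedConstraints G s k q).ofLp := by
    funext r
    cases r <;> simp [formationError, weightedConstraints, rigidityFunction]
  have hv : weightedRigidityMatrix G s k p *ᵥ v.ofLp =
      (fderiv ℝ (weightedConstraints G s k) p v).ofLp := by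
    funext r
    rw [fderiv_weightedConstraints_apply G hs, ← rigidityMatrix_mulVec]
    simp only [mulVec, dotProduct, weightedRigidityMatrix, Matrix.of_apply, mul_assoc,
      Finset.mul_sum]
  rw [EuclideanSpace.inner_eq_star_dotProduct, EuclideanSpace.inner_eq_star_dotProduct, ← he, ← hv]
  simp only [controlLaw, star_trivial, dotProduct_neg]
  rw [mulVec_transpose, dotProduct_comm, ← dotProduct_mulVec, dotProduct_comm]

/-- Since `k ≠ 0`, weighting the rows does not change the kernel of the rigidity matrix, and by IRDS
that kernel consists of trivial motions. -/
theorem mem_ker_orthogonal_of_isIRDS {q w : Config d n} (hk : k ≠ 0)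
    (hs : ∀ t, ContDiffAt ℝ 2 (fun x => s x t) q) (hq : IsIRDS G s q)
    (hw : ∀ v, IsTrivialMotion q v → inner ℝ w v = 0) :
    w ∈ (LinearMap.ker (fderiv ℝ (weightedConstraints G s k) q :
      Config d n →ₗ[ℝ] EuclideanSpace ℝ (G.edgeSet ⊕ ι)))ᗮ := by
  rw [Submodule.mem_orthogonal']
  intro v hv
  refine hw v (hq v ?_)
  funext r
  rw [rigidityMatrix_mulVec, Pi.zero_apply]
  have h1 : fderiv ℝ (weightedConstraints G s k) q v = 0 := hv
  have h2 := fderiv_weightedConstraints_apply G (k := k) hs v r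
  rw [h1] at h2
  refine (mul_eq_zero.1 h2.symm).resolve_left ?_
  cases r with
  | inl e => exact one_ne_zero
  | inr t => exact hk

/-- The argument common to both dimensions: of the signed constraints it uses only smoothness on an
open domain and invariance under rigid motions. -/
theorem locallyExponentiallyConvergent_of_isIRDS {χ : Set (Config d n)} {q : Config d n}
    (hk : k ≠ 0) (hχ : IsOpen χ)
    (hχinv : ∀ Q ∈ Matrix.specialOrthogonalGroup (Fin d) ℝ, ∀ (b : Fin d → ℝ),
      rotate Q q + translate b ∈ χ)
    (hs : ∀ x ∈ χ, ∀ t, ContDiffAt ℝ 2 (fun x => s x t) x)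
    (hinv : ∀ Q ∈ Matrix.specialOrthogonalGroup (Fin d) ℝ, ∀ (b : Fin d → ℝ) (p : Config d n),
      s (rotate Q p + translate b) = s p)
    (hq : IsIRDS G s q) :
    LocallyExponentiallyConvergent χ (controlLaw G s k q) (congruenceClass q) := by
  have hqχ : q ∈ χ := by simpa [rotate_one] using hχinv 1 (one_mem _) 0
  set F := weightedConstraints G s k with hFdef
  have hF : ∀ x ∈ χ, ContDiffAt ℝ 2 F x := fun x hx => contDiffAt_weightedConstraints G (hs x hx)
  have hFinv : ∀ {Q : Matrix (Fin d) (Fin d) ℝ},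
      Q ∈ Matrix.specialOrthogonalGroup (Fin d) ℝ → ∀ (b : Fin d → ℝ) (p : Config d n),
      F (rotate Q p + translate b) = F p :=
    fun hQ b p => weightedConstraints_rigid_motion G hinv hQ b p
  obtain ⟨a, ha, hker⟩ := exists_le_norm_of_mem_ker_orthogonal (fderiv ℝ F q)
  obtain ⟨δ, hδ, hslice⟩ := gradient_dominated_on_slice ((hF q hqχ).of_le (by norm_num)) ha hker
  intro pstar hpstar
  obtain ⟨P, hP, c, hPc⟩ := hpstar
  have hpeq : pstar = rotate P q + translate c := Config.ext_pos hPc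
  have hpχ : pstar ∈ χ := hpeq ▸ hχinv P hP c
  have hnear : ∀ᶠ x in 𝓝 pstar, a / 4 * ‖F x - F q‖ ≤ ‖residualFlow F (F q) x‖ ∧
      (F x = F q → x ∈ congruenceClass q) := by
    filter_upwards [Metric.ball_mem_nhds pstar hδ] with x hx
    obtain ⟨Q, hQ, b, hmin⟩ := exists_closest_rigid_motion x q
    set y := rotate Q x + translate b with hy
    -- The inverse of the motion taking `q` to `pstar` competes in the minimization and takes `x` to
    -- distance `‖x - pstar‖` from `q`.
    have hyδ : ‖y - q‖ < δ := by
      have hPT := transpose_mem_specialOrthogonalGroup hP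
      have h1 : rotate Pᵀ x + translate (-(Pᵀ *ᵥ c)) - q = rotate Pᵀ (x - pstar) := by
        rw [hpeq, map_sub, map_add, ← rotate_mul,
          mul_eq_one_comm.1 (mem_specialOrthogonalGroup.1 hP).1, rotate_one, rotate_translate,
          map_neg]
        abel
      have h2 := hmin Pᵀ hPT (-(Pᵀ *ᵥ c))
      rw [h1, norm_rotate hPT, ← dist_eq_norm x] at h2
      exact h2.trans_lt hx
    have hyN : y - q ∈ (LinearMap.ker (fderiv ℝ F q :
        Config d n →ₗ[ℝ] EuclideanSpace ℝ (G.edgeSet ⊕ ι)))ᗮ := by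
      refine mem_ker_orthogonal_of_isIRDS G hk (hs q hqχ) hq fun v hv =>
        inner_trivialMotion_eq_zero (fun R hR e => ?_) hv
      -- A rigid motion of `y` is one of `x`, so `y` is closest to `q` among its own rigid motions.
      have h1 : rotate R y + translate e = rotate (R * Q) x + translate (R *ᵥ b + e) := by
        rw [hy, map_add, rotate_mul, rotate_translate, map_add, add_assoc]
      rw [h1]
      exact hmin _ (mul_mem hR hQ) _
    obtain ⟨h1, h2⟩ := hslice y hyδ hyN
    have hres : ‖residualFlow F (F q) y‖ = ‖residualFlow F (F q) x‖ :=
      norm_residualFlow_of_invariant (rotateIsometry Q hQ) (translate b)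
        (fun z => hFinv hQ b z) x
    have hFy : F y = F x := hFinv hQ b x
    rw [hres, hFy] at h2
    refine ⟨h2, fun hx0 => ?_⟩
    rw [hFy, hx0, sub_self, norm_zero] at h1
    have hyq : y = q := by
      have : ‖y - q‖ ≤ 0 := by
        by_contra hcon
        have := mul_pos (half_pos ha) (not_le.1 hcon)
        linarith
      exact sub_eq_zero.1 (norm_le_zero_iff.1 this)
    -- As `y = q`, the inverse motion takes `q` back to `x`.
    refine ⟨Qᵀ, transpose_mem_specialOrthogonalGroup hQ, -(Qᵀ *ᵥ b), fun i => ?_⟩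
    rw [← hyq, hy, pos_rotate_add_translate, mulVec_add, mulVec_mulVec,
      mul_eq_one_comm.1 (mem_specialOrthogonalGroup.1 hQ).1, one_mulVec, add_neg_cancel_right]
  have hflow : ∀ x ∈ χ, controlLaw G s k q x = residualFlow F (F q) x :=
    fun x hx => controlLaw_eq_residualFlow G (hs x hx) q
  obtain ⟨B, hB, C, hC, γ, hγ, hmain⟩ := exists_nhds_exponentially_convergent
    (ψ := congruenceClass q) hχ hF hpχ (w₀ := F q) (by rw [hpeq]; exact hFinv hP c q)
    (by positivity : 0 < a / 4) (hnear.mono fun x hx => hx.1) (hnear.mono fun x hx => hx.2)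
  refine ⟨B, hB, C, hC, γ, hγ, fun p₀ hp₀ => ⟨?_, fun p hp hp0 => ?_⟩⟩
  · obtain ⟨p, ⟨hp, hpχ⟩, hp0⟩ := (hmain p₀ hp₀).1
    refine ⟨p, ⟨fun t ht => ?_, hpχ⟩, hp0⟩
    have := hp t ht
    simp only [← hflow _ (hpχ t ht)] at this
    exact this
  · refine (hmain p₀ hp₀).2 p (fun t ht => ?_) hp0
    have := hp.1 t ht
    simp only [hflow _ (hp.2 t ht)] at this
    exact this

theorem contDiffAt_bearing {i j : Fin n} (h : pos p j ≠ pos p i) :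
    ContDiffAt ℝ 2 (fun x : Config d n => bearing x i j) p := by
  have h1 : ContDiffAt ℝ 2 (fun x : Config d n => relPos x j i) p :=
    ((contDiff_pos j).sub (contDiff_pos i)).contDiffAt
  have h2 : relPos p j i ≠ 0 := sub_ne_zero.2 h
  exact ((h1.norm ℝ h2).inv (norm_ne_zero_iff.2 h2)).smul h1

theorem contDiffAt_bearing_apply {i j : Fin n} (h : pos p j ≠ pos p i) (a : Fin d) :
    ContDiffAt ℝ 2 (fun x : Config d n => bearing x i j a) p :=
  contDiffAt_euclidean.1 (contDiffAt_bearing h) a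

theorem isOpen_pos_ne (i j : Fin n) : IsOpen {p : Config d n | pos p j ≠ pos p i} :=
  isOpen_ne_fun (contDiff_pos j).continuous (contDiff_pos i).continuous

theorem pos_ne_rigid_motion (hQ : Q ∈ Matrix.specialOrthogonalGroup (Fin d) ℝ)
    (b : Fin d → ℝ) {i j : Fin n} (h : pos p j ≠ pos p i) :
    pos (rotate Q p + translate b) j ≠ pos (rotate Q p + translate b) i := by
  rw [← sub_ne_zero, ← norm_ne_zero_iff] at h ⊢
  change ‖relPos _ j i‖ ≠ 0
  rwa [relPos_rigid_motion, norm_toLp_mulVec hQ]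

end Constraints

/-! ### Signed angles in the plane and signed volumes in space -/

section SignedConstraints

variable {n : ℕ}

theorem isOpen_angleDomain (S : Finset (Fin n × Fin n × Fin n)) : IsOpen (angleDomain S) := by
  have : angleDomain S = ⋂ t ∈ S, {p | pos p t.2.1 ≠ pos p t.1} ∩ {p | pos p t.2.2 ≠ pos p t.1} := by
    ext p; simp [angleDomain]
  rw [this]
  exact isOpen_biInter_finset fun t _ => (isOpen_pos_ne _ _).inter (isOpen_pos_ne _ _)

theorem isOpen_volumeDomain (S : Finset (Fin n × Fin n × Fin n × Fin n)) :
    IsOpen (volumeDomain S) := by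
  have : volumeDomain S = ⋂ t ∈ S, {p | pos p t.2.1 ≠ pos p t.1} ∩
      ({p | pos p t.2.2.1 ≠ pos p t.1} ∩ {p | pos p t.2.2.2 ≠ pos p t.1}) := by
    ext p; simp [volumeDomain]
  rw [this]
  exact isOpen_biInter_finset fun t _ =>
    (isOpen_pos_ne _ _).inter ((isOpen_pos_ne _ _).inter (isOpen_pos_ne _ _))

theorem signedAngle_rigid_motion {Q : Matrix (Fin 2) (Fin 2) ℝ}
    (hQ : Q ∈ Matrix.specialOrthogonalGroup (Fin 2) ℝ) (b : Fin 2 → ℝ) (p : Config 2 n)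
    (t : Fin n × Fin n × Fin n) :
    signedAngle (rotate Q p + translate b) t = signedAngle p t := by
  have hdet := (mem_specialOrthogonalGroup.1 hQ).2
  rw [det_fin_two] at hdet
  simp only [signedAngle, bearing_rigid_motion hQ, det_fin_two_of, mulVec, dotProduct,
    Fin.sum_univ_two]
  linear_combination (bearing p t.1 t.2.1 0 * bearing p t.1 t.2.2 1 -
    bearing p t.1 t.2.2 0 * bearing p t.1 t.2.1 1) * hdet

theorem signedVolume_rigid_motion {Q : Matrix (Fin 3) (Fin 3) ℝ}
    (hQ : Q ∈ Matrix.specialOrthogonalGroup (Fin 3) ℝ) (b : Fin 3 → ℝ) (p : Config 3 n)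
    (t : Fin n × Fin n × Fin n × Fin n) :
    signedVolume (rotate Q p + translate b) t = signedVolume p t := by
  simp only [signedVolume, bearing_rigid_motion hQ, triple_product_eq_det]
  set u := (bearing p t.1 t.2.1).ofLp
  set v := (bearing p t.1 t.2.2.1).ofLp
  set w := (bearing p t.1 t.2.2.2).ofLp
  -- The triple product is the determinant with rows `u`, `v`, `w`; rotating the rows multiplies the
  -- matrix by `Qᵀ` on the right.
  have h : Matrix.of ![Q *ᵥ u, Q *ᵥ v, Q *ᵥ w] = Matrix.of ![u, v, w] * Qᵀ := by
    ext i j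
    fin_cases i <;> simp [Matrix.mul_apply, mulVec, dotProduct, mul_comm]
  change (Matrix.of ![Q *ᵥ u, Q *ᵥ v, Q *ᵥ w]).det = (Matrix.of ![u, v, w]).det
  rw [h, det_mul, det_transpose, (mem_specialOrthogonalGroup.1 hQ).2, mul_one]

theorem contDiffAt_signedAngle {p : Config 2 n} {t : Fin n × Fin n × Fin n}
    (h₁ : pos p t.2.1 ≠ pos p t.1) (h₂ : pos p t.2.2 ≠ pos p t.1) :
    ContDiffAt ℝ 2 (fun x => signedAngle x t) p := by
  simp only [signedAngle, det_fin_two_of]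
  exact ((contDiffAt_bearing_apply h₁ 0).mul (contDiffAt_bearing_apply h₂ 1)).sub
    ((contDiffAt_bearing_apply h₂ 0).mul (contDiffAt_bearing_apply h₁ 1))

theorem contDiffAt_signedVolume {p : Config 3 n} {t : Fin n × Fin n × Fin n × Fin n}
    (h₁ : pos p t.2.1 ≠ pos p t.1) (h₂ : pos p t.2.2.1 ≠ pos p t.1)
    (h₃ : pos p t.2.2.2 ≠ pos p t.1) :
    ContDiffAt ℝ 2 (fun x => signedVolume x t) p := by
  have e₁ := contDiffAt_bearing_apply h₁
  have e₂ := contDiffAt_bearing_apply h₂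
  have e₃ := contDiffAt_bearing_apply h₃
  simp only [signedVolume, cross_apply, vec3_dotProduct, cons_val_zero, cons_val_one, cons_val]
  exact (((e₁ 0).mul (((e₂ 1).mul (e₃ 2)).sub ((e₂ 2).mul (e₃ 1)))).add
    ((e₁ 1).mul (((e₂ 2).mul (e₃ 0)).sub ((e₂ 0).mul (e₃ 2))))).add
    ((e₁ 2).mul (((e₂ 0).mul (e₃ 1)).sub ((e₂ 1).mul (e₃ 0))))

end SignedConstraints

end FormationControl

end

theorem mainTheorem5 (n : ℕ) (G : SimpleGraph (Fin n)) [DecidableRel G.Adj] (k : ℝ) (hk : k ≠ 0) :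
    (∀ (S : Finset (Fin n × Fin n × Fin n)) (q : FormationControl.Config 2 n),
      q ∈ FormationControl.angleDomain S →
      FormationControl.IsIRDS G (FormationControl.signedAngles S) q →
      FormationControl.LocallyExponentiallyConvergent (FormationControl.angleDomain S)
        (FormationControl.controlLaw G (FormationControl.signedAngles S) k q)
        (FormationControl.congruenceClass q)) ∧
    (∀ (S : Finset (Fin n × Fin n × Fin n × Fin n)) (q : FormationControl.Config 3 n),
      q ∈ FormationControl.volumeDomain S →
      FormationControl.IsIRDS G (FormationControl.signedVolumes S) q →
      FormationControl.LocallyExponentiallyConvergent (FormationControl.volumeDomain S)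
        (FormationControl.controlLaw G (FormationControl.signedVolumes S) k q)
        (FormationControl.congruenceClass q)) := by
  refine ⟨fun S q hq hrigid => ?_, fun S q hq hrigid => ?_⟩
  · exact FormationControl.locallyExponentiallyConvergent_of_isIRDS G hk
      (FormationControl.isOpen_angleDomain S)
      (fun Q hQ b t ht => ⟨FormationControl.pos_ne_rigid_motion hQ b (hq t ht).1,
        FormationControl.pos_ne_rigid_motion hQ b (hq t ht).2⟩)
      (fun x hx t => FormationControl.contDiffAt_signedAngle (hx t t.2).1 (hx t t.2).2)
      (fun Q hQ b p => funext fun t => FormationControl.signedAngle_rigid_motion hQ b p t) hrigid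
  · exact FormationControl.locallyExponentiallyConvergent_of_isIRDS G hk
      (FormationControl.isOpen_volumeDomain S)
      (fun Q hQ b t ht => ⟨FormationControl.pos_ne_rigid_motion hQ b (hq t ht).1,
        FormationControl.pos_ne_rigid_motion hQ b (hq t ht).2.1,
        FormationControl.pos_ne_rigid_motion hQ b (hq t ht).2.2⟩)
      (fun x hx t => FormationControl.contDiffAt_signedVolume (hx t t.2).1 (hx t t.2).2.1
        (hx t t.2).2.2)
      (fun Q hQ b p => funext fun t => FormationControl.signedVolume_rigid_motion hQ b p t) hrigid
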